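/- Let $p,q\ge 0$ be integers, $\mu_1,\mu_2\in\mathbb R$ and $\beta=(\beta_1,\dots,\beta_{p+q})^t\in\mathbb R^{p+q}$. On a probability space let $x_{i,j}$ ($i\ge 1$, $1\le j\le p+q$) be mutually independent real random variables such that, for each $j$, every $x_{i,j}$ has the distribution of a random variable $X_j$ with $\mathbb E X_j=0$ and $\mathbb E X_j^2<\infty$, and suppose that $\mathrm{Var}(X_j)>0$ for $1\le j\le p$. Let $\epsilon_1,\epsilon_2,\dots$ be i.i.d. with mean zero and finite variance. For each $n$ let $T_{n,1},\dots,T_{n,n}$ be $\{0,1\}$-valued random variables (the treatment assignments of the first $n$ units; write $T_i=T_{n,i}$), which may depend on the covariates. Assume that the family $(\epsilon_i)_i$ is independent of $(x_{i,j})_{i,j}$ and that, for each $n$, $(\epsilon_1,\dots,\epsilon_n)$ is independent of $(T_{n,1},\dots,T_{n,n})$. The outcomes are $$Y_i=\mu_1T_i+\mu_2(1-T_i)+\sum_{j=1}^{p+q}\beta_jx_{i,j}+\epsilon_i,\qquad i=1,\dots,n .$$ Put $\mathbf x_i=(x_{i,1},\dots,x_{i,p+q})^t$, $\mathbf X_{\rm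 in}=(x_{i,j})_{i\le n,\,j\le p}$, $\mathbf X_{\rm ex}=(x_{i,p+j})_{i\le n,\,j\le q}$, $\mathbf T=(T_1,\dots,T_n)^t$, $\mathbf Y=(Y_1,\dots,Y_n)^t$, $\boldsymbol\epsilon=(\epsilon_1,\dots,\epsilon_n)^t$, $\beta_{\rm ex}=(\beta_{p+1},\dots,\beta_{p+q})^t$ and $\theta=(\mu_1,\mu_2,\beta_1,\dots,\beta_p)^t$. The working model uses only the first $p$ covariates: its design matrix is $\mathbf G=[\mathbf T;\ \mathbf 1_n-\mathbf T;\ \mathbf X_{\rm in}]$ (listed by blocks of columns), and its ordinary least squares estimator is $\hat\theta=(\mathbf G^t\mathbf G)^{-1}\mathbf G^t\mathbf Y$ (where $\mathbf G^t\mathbf G$ is singular, $\hat\theta$ is set to $0$). Assume 1. (global balance) $n^{-1}\sum_{i=1}^n(2T_i-1)\to 0$ in probability; 2. (covariate balance) $n^{-1/2}\sum_{i=1}^n(2T_i-1)\mathbf x_i\to\xi$ in distribution, where $\xi$ is a $(p+q)$-dimensional random vector with $\mathbb E\xi=0$. Then, as $n\to\infty$, $\mathbf G^t\mathbf G$ is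 invertible with probability tending to one, $\hat\theta$ is consistent, i.e. $\hat\theta\to\theta$ in probability, and $$\sqrt n(\hat\theta-\theta)=\frac1{\sqrt n}\,\mathbf V^{-1}\mathbf G^t(\mathbf X_{\rm ex}\beta_{\rm ex}+\boldsymbol\epsilon)+o_P(1),\qquad \mathbf V=\mathrm{diag}\bigl(\tfrac12,\tfrac12,\mathrm{Var}(X_1),\dots,\mathrm{Var}(X_p)\bigr).$$ -/

import Mathlib

open MeasureTheory ProbabilityTheory Filter Topology
open scoped Matrix

/-- The design matrix `G = [T; 1 - T; X_in]` of the working model with `n` units: the first two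
columns are the two treatment indicators, the others are the first `p` of the `p + q` covariates. -/
def designMatrix {Ω : Type*} {p q : ℕ} (T : (n : ℕ) → Fin n → Ω → ℝ)
    (x : ℕ → Fin (p + q) → Ω → ℝ) (n : ℕ) (ω : Ω) : Matrix (Fin n) (Fin 2 ⊕ Fin p) ℝ :=
  Matrix.of fun i => Sum.elim ![T n i ω, 1 - T n i ω] fun j => x i (Fin.castAdd q j) ω

/-- The matrix `X_ex` of the last `q` covariates, which the working model leaves out. -/
def excludedCovariates {Ω : Type*} {p q : ℕ} (x : ℕ → Fin (p + q) → Ω → ℝ) (n : ℕ) (ω : Ω) :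
    Matrix (Fin n) (Fin q) ℝ :=
  Matrix.of fun i j => x i (Fin.natAdd p j) ω

/-- The outcomes `Y` of `n` units under the true linear model, with all `p + q` covariates. -/
def outcome {Ω : Type*} {p q : ℕ} (μ₁ μ₂ : ℝ) (β : Fin (p + q) → ℝ)
    (T : (n : ℕ) → Fin n → Ω → ℝ) (x : ℕ → Fin (p + q) → Ω → ℝ) (ε : ℕ → Ω → ℝ)
    (n : ℕ) (ω : Ω) : Fin n → ℝ :=
  fun i => μ₁ * T n i ω + μ₂ * (1 - T n i ω) + ∑ j, β j * x i j ω + ε i ω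

/-- The parameter `θ = (μ₁, μ₂, β₁, …, β_p)` of the working model. -/
def workingParameter {p q : ℕ} (μ₁ μ₂ : ℝ) (β : Fin (p + q) → ℝ) : Fin 2 ⊕ Fin p → ℝ :=
  Sum.elim ![μ₁, μ₂] fun j => β (Fin.castAdd q j)

/-- The coefficients `β_ex = (β_{p+1}, …, β_{p+q})` of the excluded covariates. -/
def excludedCoefficients {p q : ℕ} (β : Fin (p + q) → ℝ) : Fin q → ℝ :=
  fun j => β (Fin.natAdd p j)

/-- The ordinary least squares estimate `(GᵗG)⁻¹ Gᵗ Y`. -/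
noncomputable def olsEstimate {n p : ℕ} (G : Matrix (Fin n) (Fin 2 ⊕ Fin p) ℝ) (Y : Fin n → ℝ) :
    Fin 2 ⊕ Fin p → ℝ :=
  (Gᵀ * G)⁻¹ *ᵥ (Gᵀ *ᵥ Y)

/-- The matrix `V = diag(1/2, 1/2, Var X₁, …, Var X_p)`. -/
noncomputable def limitMatrix {Ω : Type*} [MeasurableSpace Ω] {p q : ℕ} (P : Measure Ω)
    (X : Fin (p + q) → Ω → ℝ) : Matrix (Fin 2 ⊕ Fin p) (Fin 2 ⊕ Fin p) ℝ :=
  Matrix.diagonal (Sum.elim (fun _ => 1 / 2) fun j => variance (X (Fin.castAdd q j)) P)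

/-! With `u = X_ex β_ex + ε` the outcomes satisfy `Y = G θ + u` exactly, so where `GᵗG` is
invertible `√n (θ̂ - θ) = A⁻¹ Z` with `A = GᵗG / n` and `Z = Gᵗu / √n`. Two facts suffice: `A → V`
in probability (`tendstoInMeasure_gram_designMatrix`), and `Z` is bounded in probability
(`boundedInMeasure_score_designMatrix`). Then `(A⁻¹ - V⁻¹) Z` is o_P(1) times O_P(1), which gives
the representation, and dividing by `√n` gives consistency (`leastSquares_asymptotics`). No central
limit theorem is needed.

The entries of `A` and `Z` reduce to a few kinds of sums. Covariates weighted by assignments are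
controlled by covariate balance, through tightness of a sequence converging in distribution.
Products of distinct covariates, and errors weighted by one column of `G`, have orthogonal summands,
so Chebyshev applies. A column of `G` involves assignments or a covariate, never both, so separate
independence of the errors from each is enough. The diagonal of `A` comes from global balance and
the strong law. -/

/-! ### Convergence and boundedness in probability -/

section ConvergenceInMeasure

variable {Ω : Type*} [MeasurableSpace Ω] {P : Measure Ω}

/-- A sequence of random elements is bounded in probability if its tails are eventually
uniformly small. -/
def BoundedInMeasure {E : Type*} [Norm E] (P : Measure Ω) (f : ℕ → Ω → E) : Prop :=
  ∀ δ : ENNReal, 0 < δ → ∃ M : ℝ, ∀ᶠ n in atTop, P {ω | M ≤ ‖f n ω‖} ≤ δ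

theorem tendstoInMeasure_pi {ι E : Type*} [Fintype ι] [PseudoEMetricSpace E]
    {f : ℕ → Ω → ι → E} {g : Ω → ι → E}
    (h : ∀ i, TendstoInMeasure P (fun n ω => f n ω i) atTop (fun ω => g ω i)) :
    TendstoInMeasure P f atTop g := by
  intro η hη
  have hsum : Tendsto (fun n => ∑ i, P {ω | η ≤ edist (f n ω i) (g ω i)}) atTop (𝓝 0) := by
    simpa using tendsto_finsetSum Finset.univ fun i _ => h i η hη
  refine tendsto_of_tendsto_of_tendsto_of_le_of_le tendsto_const_nhds hsum
    (fun _ => zero_le) fun n => ?_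
  refine (measure_mono ?_).trans (measure_iUnion_fintype_le P _)
  intro ω hω
  by_contra hcon
  simp only [Set.mem_iUnion, Set.mem_ofPred_eq, not_exists, not_le] at hcon hω
  rw [edist_pi_def] at hω
  exact absurd hω (not_le.2 ((Finset.sup_lt_iff hη).2 fun i _ => hcon i))

/-- Because the limit is constant, continuity at that one point is enough; matrix inversion at `V`
offers no more. -/
theorem MeasureTheory.TendstoInMeasure.comp_continuousAt {E F : Type*} [PseudoEMetricSpace E]
    [PseudoEMetricSpace F] {f : ℕ → Ω → E} {c : E} {g : E → F}
    (hf : TendstoInMeasure P f atTop fun _ => c) (hg : ContinuousAt g c) :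
    TendstoInMeasure P (fun n ω => g (f n ω)) atTop fun _ => g c := by
  intro η hη
  obtain ⟨δ, hδ, h⟩ := EMetric.tendsto_nhds_nhds.1 hg η hη
  refine tendsto_of_tendsto_of_tendsto_of_le_of_le tendsto_const_nhds (hf δ hδ)
    (fun _ => zero_le) fun n => measure_mono fun ω hω => ?_
  by_contra hcon
  exact absurd hω (not_le.2 (h (not_le.1 hcon)))

/-- Used to discard the vanishing event on which the Gram matrix is singular. -/
theorem MeasureTheory.TendstoInMeasure.congr_of_tendsto_measure {E : Type*} [PseudoEMetricSpace E]
    {f f' : ℕ → Ω → E} {g : Ω → E} (hf : TendstoInMeasure P f atTop g) {s : ℕ → Set Ω}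
    (hs : Tendsto (fun n => P (s n)) atTop (𝓝 0)) (h : ∀ᶠ n in atTop, ∀ ω ∉ s n, f n ω = f' n ω) :
    TendstoInMeasure P f' atTop g := by
  intro η hη
  have hsum := (hf η hη).add hs
  rw [add_zero] at hsum
  refine tendsto_of_tendsto_of_tendsto_of_le_of_le' tendsto_const_nhds hsum
    (.of_forall fun _ => zero_le) ?_
  filter_upwards [h] with n hn
  refine (measure_mono fun ω hω => ?_).trans (measure_union_le _ _)
  by_cases hmem : ω ∈ s n
  · exact Or.inr hmem
  · left
    simpa [hn ω hmem] using hω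

theorem tendstoInMeasure_congr_eventually {E : Type*} [PseudoEMetricSpace E]
    {f f' : ℕ → Ω → E} {g : Ω → E} (hf : TendstoInMeasure P f atTop g)
    (h : ∀ᶠ n in atTop, ∀ ω, f n ω = f' n ω) : TendstoInMeasure P f' atTop g :=
  hf.congr' (h.mono fun _ hn => .of_forall hn) .rfl

theorem tendstoInMeasure_of_tendsto_const {E : Type*} [PseudoEMetricSpace E] {a : ℕ → E} {c : E}
    (h : Tendsto a atTop (𝓝 c)) : TendstoInMeasure P (fun n _ => a n) atTop fun _ => c := by
  intro η hη
  refine tendsto_const_nhds.congr' ?_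
  filter_upwards [EMetric.tendsto_nhds.1 h η hη] with n hn
  simp [not_le.2 hn]

theorem MeasureTheory.TendstoInMeasure.add_const_limits {E : Type*} [SeminormedAddCommGroup E]
    {f g : ℕ → Ω → E} {a b : E} (hf : TendstoInMeasure P f atTop fun _ => a)
    (hg : TendstoInMeasure P g atTop fun _ => b) :
    TendstoInMeasure P (fun n ω => f n ω + g n ω) atTop fun _ => a + b := by
  intro η hη
  have hη2 : 0 < η / 2 := ENNReal.half_pos hη.ne'
  have hsum := (hf _ hη2).add (hg _ hη2)
  rw [add_zero] at hsum
  refine tendsto_of_tendsto_of_tendsto_of_le_of_le tendsto_const_nhds hsum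
    (fun _ => zero_le) fun n => (measure_mono fun ω hω => ?_).trans (measure_union_le _ _)
  by_contra hcon
  simp only [Set.mem_union, Set.mem_ofPred_eq, not_or, not_le] at hcon hω
  refine absurd hω (not_le.2 ?_)
  calc edist (f n ω + g n ω) (a + b) ≤ edist (f n ω) a + edist (g n ω) b :=
        edist_add_add_le _ _ _ _
    _ < η / 2 + η / 2 := ENNReal.add_lt_add hcon.1 hcon.2
    _ = η := ENNReal.add_halves η

theorem MeasureTheory.TendstoInMeasure.const_mul_const {f : ℕ → Ω → ℝ} {a : ℝ}
    (hf : TendstoInMeasure P f atTop fun _ => a) (c : ℝ) :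
    TendstoInMeasure P (fun n ω => c * f n ω) atTop fun _ => c * a :=
  hf.comp_continuousAt (g := fun y => c * y) (by fun_prop)

theorem tendstoInMeasure_finset_sum_zero {ι E : Type*} [SeminormedAddCommGroup E] (s : Finset ι)
    {f : ι → ℕ → Ω → E} (h : ∀ i ∈ s, TendstoInMeasure P (f i) atTop fun _ => 0) :
    TendstoInMeasure P (fun n ω => ∑ i ∈ s, f i n ω) atTop fun _ => 0 := by
  classical
  induction s using Finset.induction_on with
  | empty => simpa using tendstoInMeasure_of_tendsto_const (P := P) (tendsto_const_nhds (x := (0 : E)))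
  | insert a s ha ih =>
    have := (h a (by simp)).add_const_limits (ih fun i hi => h i (by simp [hi]))
    simpa [Finset.sum_insert ha] using this

theorem MeasureTheory.TendstoInMeasure.boundedInMeasure {E : Type*} [SeminormedAddCommGroup E]
    {f : ℕ → Ω → E} (hf : TendstoInMeasure P f atTop fun _ => 0) : BoundedInMeasure P f := by
  intro δ hδ
  refine ⟨1, ?_⟩
  have := tendstoInMeasure_iff_norm.1 hf 1 one_pos
  simp only [sub_zero] at this
  exact this.eventually_le_const hδ

theorem BoundedInMeasure.add {E : Type*} [SeminormedAddCommGroup E] {f g : ℕ → Ω → E}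
    (hf : BoundedInMeasure P f) (hg : BoundedInMeasure P g) :
    BoundedInMeasure P fun n ω => f n ω + g n ω := by
  intro δ hδ
  obtain ⟨M, hM⟩ := hf _ (ENNReal.half_pos hδ.ne')
  obtain ⟨N, hN⟩ := hg _ (ENNReal.half_pos hδ.ne')
  refine ⟨M + N, ?_⟩
  filter_upwards [hM, hN] with n h1 h2
  rw [← ENNReal.add_halves δ]
  refine ((measure_mono fun ω hω => ?_).trans (measure_union_le _ _)).trans (add_le_add h1 h2)
  by_contra hcon
  simp only [Set.mem_union, Set.mem_ofPred_eq, not_or, not_le] at hcon hω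
  linarith [norm_add_le (f n ω) (g n ω)]

theorem BoundedInMeasure.const_mul {f : ℕ → Ω → ℝ} (hf : BoundedInMeasure P f) (c : ℝ) :
    BoundedInMeasure P fun n ω => c * f n ω := by
  intro δ hδ
  obtain ⟨M, hM⟩ := hf δ hδ
  -- The extra `1` and the maximum leave strict slack, so that `c = 0` and `M ≤ 0` need no separate
  -- case.
  refine ⟨(|c| + 1) * max M 1, ?_⟩
  filter_upwards [hM] with n h1
  refine (measure_mono fun ω hω => ?_).trans h1
  simp only [Set.mem_ofPred_eq, norm_mul, Real.norm_eq_abs] at hω ⊢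
  by_contra! hcon
  have h2 : |c| * |f n ω| ≤ |c| * max M 1 :=
    mul_le_mul_of_nonneg_left (hcon.le.trans (le_max_left _ _)) (abs_nonneg c)
  linarith [le_max_right M 1]

theorem boundedInMeasure_finset_sum {ι E : Type*} [SeminormedAddCommGroup E] (s : Finset ι)
    {f : ι → ℕ → Ω → E} (h : ∀ i ∈ s, BoundedInMeasure P (f i)) :
    BoundedInMeasure P fun n ω => ∑ i ∈ s, f i n ω := by
  classical
  induction s using Finset.induction_on with
  | empty =>
    simpa using (tendstoInMeasure_of_tendsto_const (P := P)
      (tendsto_const_nhds (x := (0 : E)))).boundedInMeasure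
  | insert a s ha ih =>
    have := (h a (by simp)).add (ih fun i hi => h i (by simp [hi]))
    simpa [Finset.sum_insert ha] using this

/-- The rule o_P(1) · O_P(1) = o_P(1): off an event of small probability `g` is below a fixed bound,
and `f` is eventually small relative to it. -/
theorem MeasureTheory.TendstoInMeasure.mul_boundedInMeasure {f g : ℕ → Ω → ℝ}
    (hf : TendstoInMeasure P f atTop fun _ => 0) (hg : BoundedInMeasure P g) :
    TendstoInMeasure P (fun n ω => f n ω * g n ω) atTop fun _ => 0 := by
  rw [tendstoInMeasure_iff_norm] at hf ⊢
  simp only [sub_zero] at hf ⊢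
  intro η hη
  rw [ENNReal.tendsto_nhds_zero]
  intro δ hδ
  obtain ⟨M, hM⟩ := hg _ (ENNReal.half_pos hδ.ne')
  have hM1 : 0 < max M 1 := lt_max_of_lt_right one_pos
  have hf' := (hf (η / max M 1) (by positivity)).eventually_le_const (ENNReal.half_pos hδ.ne')
  filter_upwards [hM, hf'] with n h1 h2
  rw [← ENNReal.add_halves δ]
  refine ((measure_mono fun ω hω => ?_).trans (measure_union_le _ _)).trans (add_le_add h1 h2)
  by_contra hcon
  simp only [Set.mem_union, Set.mem_ofPred_eq, not_or, not_le, norm_mul] at hcon hω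
  rw [lt_div_iff₀ hM1] at hcon
  have : ‖f n ω‖ * ‖g n ω‖ ≤ ‖f n ω‖ * max M 1 :=
    mul_le_mul_of_nonneg_left (hcon.1.le.trans (le_max_left _ _)) (norm_nonneg _)
  linarith [hcon.2]

theorem BoundedInMeasure.of_norm_le {E F : Type*} [Norm E] [Norm F] {f : ℕ → Ω → E}
    {g : ℕ → Ω → F} (hg : BoundedInMeasure P g) (h : ∀ n ω, ‖f n ω‖ ≤ ‖g n ω‖) :
    BoundedInMeasure P f := by
  intro δ hδ
  obtain ⟨M, hM⟩ := hg δ hδ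
  exact ⟨M, hM.mono fun n hn => (measure_mono fun ω hω => le_trans hω (h n ω)).trans hn⟩

/-- A sequence that converges in distribution is bounded in probability. -/
theorem MeasureTheory.TendstoInDistribution.boundedInMeasure {Ω' E : Type*} [MeasurableSpace Ω']
    {P' : Measure Ω'} [IsProbabilityMeasure P] [IsProbabilityMeasure P'] [NormedAddCommGroup E]
    [MeasurableSpace E] [BorelSpace E] {f : ℕ → Ω → E} {ξ : Ω' → E}
    (h : TendstoInDistribution f atTop ξ (fun _ => P) P') : BoundedInMeasure P f := by
  intro δ hδ
  have hclosed : ∀ M : ℝ, IsClosed {y : E | M ≤ ‖y‖} := fun M =>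
    isClosed_le continuous_const continuous_norm
  have htail : Tendsto (fun k : ℕ => (P'.map ξ) {y : E | (k : ℝ) ≤ ‖y‖}) atTop (𝓝 0) := by
    have := Measure.isProbabilityMeasure_map (μ := P') h.aemeasurable_limit
    have hempty : ⋂ k : ℕ, {y : E | (k : ℝ) ≤ ‖y‖} = ∅ := by
      ext y
      obtain ⟨k, hk⟩ := exists_nat_gt ‖y‖
      simpa using ⟨k, hk⟩
    rw [← measure_empty (μ := P'.map ξ), ← hempty]
    refine tendsto_measure_iInter_atTop (fun k => (hclosed k).measurableSet.nullMeasurableSet)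
      (fun a b hab y hy => ?_) ⟨0, measure_ne_top _ _⟩
    simp only [Set.mem_ofPred_eq] at hy ⊢
    exact le_trans (Nat.cast_le.2 hab) hy
  obtain ⟨k, hk⟩ := (htail.eventually_lt_const hδ).exists
  refine ⟨k, ?_⟩
  -- Portmanteau for the closed tail set, whose limiting mass was made less than `δ` by continuity
  -- from above.
  have hlim := ProbabilityMeasure.limsup_measure_closed_le_of_tendsto h.tendsto (hclosed k)
  have hev := eventually_lt_of_limsup_lt (lt_of_le_of_lt hlim hk)
  filter_upwards [hev] with n hn
  simp only [ProbabilityMeasure.coe_mk] at hn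
  rw [Measure.map_apply_of_aemeasurable (h.forall_aemeasurable n) (hclosed k).measurableSet] at hn
  exact hn.le

/-- A sequence with uniformly bounded second moments is bounded in probability. -/
theorem boundedInMeasure_of_integral_sq_le [IsFiniteMeasure P] {f : ℕ → Ω → ℝ}
    (hf : ∀ n, MemLp (f n) 2 P) {C : ℝ} (hC : ∀ n, ∫ ω, f n ω ^ 2 ∂P ≤ C) :
    BoundedInMeasure P f := by
  intro δ hδ
  have hC0 : 0 ≤ C := (integral_nonneg fun ω => sq_nonneg _).trans (hC 0)
  obtain ⟨r, hr0, hr⟩ : ∃ r : ℝ, 0 < r ∧ ENNReal.ofReal r ≤ δ := by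
    obtain ⟨r, hr⟩ := ENNReal.lt_iff_exists_nnreal_btwn.1 hδ
    exact ⟨r, by exact_mod_cast hr.1, by simpa using hr.2.le⟩
  -- Markov's inequality for the square at level `(C + 1) / r` gives probability at most `C r / (C +
  -- 1) ≤ r`; the `+ 1` keeps the level positive when `C = 0`.
  refine ⟨√((C + 1) / r), .of_forall fun n => le_trans ?_ hr⟩
  have hM : 0 < (C + 1) / r := by positivity
  have hmarkov := mul_meas_ge_le_integral_of_nonneg (μ := P) (f := fun ω => f n ω ^ 2)
    (.of_forall fun ω => sq_nonneg _) (hf n).integrable_sq ((C + 1) / r)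
  have hset : {ω | √((C + 1) / r) ≤ ‖f n ω‖} = {ω | (C + 1) / r ≤ f n ω ^ 2} := by
    ext ω
    simp only [Set.mem_ofPred_eq, Real.norm_eq_abs]
    rw [Real.sqrt_le_left (abs_nonneg _), sq_abs]
  rw [hset, ← ofReal_measureReal]
  refine ENNReal.ofReal_le_ofReal ?_
  have h1 := hmarkov.trans (hC n)
  rw [div_mul_eq_mul_div, div_le_iff₀ hr0] at h1
  nlinarith [measureReal_nonneg (μ := P) (s := {ω | (C + 1) / r ≤ f n ω ^ 2})]

/-- Normalized row sums of a triangular array with orthogonal entries of bounded variance are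
bounded in probability. -/
theorem boundedInMeasure_inv_sqrt_mul_sum [IsFiniteMeasure P] {z : (n : ℕ) → Fin n → Ω → ℝ}
    (hz : ∀ n i, MemLp (z n i) 2 P) {C : ℝ} (hC : ∀ n i, ∫ ω, z n i ω ^ 2 ∂P ≤ C)
    (horth : ∀ n i k, i ≠ k → ∫ ω, z n i ω * z n k ω ∂P = 0) :
    BoundedInMeasure P fun n ω => (√(n : ℝ))⁻¹ * ∑ i, z n i ω := by
  have hsum : ∀ n, ∫ ω, (∑ i, z n i ω) ^ 2 ∂P ≤ n * C := by
    intro n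
    have hint : ∀ i k, Integrable (fun ω => z n i ω * z n k ω) P := fun i k =>
      (hz n i).integrable_mul (hz n k)
    have h1 : ∫ ω, (∑ i, z n i ω) ^ 2 ∂P = ∑ i, ∑ k, ∫ ω, z n i ω * z n k ω ∂P := by
      simp_rw [sq, Finset.sum_mul_sum]
      rw [integral_finsetSum _ fun i _ => integrable_finsetSum _ fun k _ => hint i k]
      refine Finset.sum_congr rfl fun i _ => ?_
      rw [integral_finsetSum _ fun k _ => hint i k]
    rw [h1]
    calc ∑ i, ∑ k, ∫ ω, z n i ω * z n k ω ∂P = ∑ i, ∫ ω, z n i ω ^ 2 ∂P := by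
          refine Finset.sum_congr rfl fun i _ => ?_
          rw [Finset.sum_eq_single i (fun k _ hk => horth n i k hk.symm) (by simp)]
          simp_rw [sq]
      _ ≤ ∑ _i : Fin n, C := Finset.sum_le_sum fun i _ => hC n i
      _ = n * C := by simp
  refine boundedInMeasure_of_integral_sq_le (C := max C 0) (fun n => ?_) fun n => ?_
  · exact (memLp_finsetSum _ fun i _ => hz n i).const_mul _
  · simp_rw [mul_pow]
    rw [integral_const_mul]
    rcases Nat.eq_zero_or_pos n with rfl | hn
    · simp
    · have hn' : (0 : ℝ) < n := Nat.cast_pos.2 hn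
      rw [inv_pow, Real.sq_sqrt hn'.le, inv_mul_le_iff₀ hn']
      exact (hsum n).trans (mul_le_mul_of_nonneg_left (le_max_left _ _) hn'.le)

theorem tendsto_inv_sqrt_atTop_zero : Tendsto (fun n : ℕ => (√(n : ℝ))⁻¹) atTop (𝓝 0) :=
  tendsto_inv_atTop_zero.comp (Real.tendsto_sqrt_atTop.comp tendsto_natCast_atTop_atTop)

theorem inv_sqrt_mul_inv_sqrt_natCast (n : ℕ) : (√(n : ℝ))⁻¹ * (√(n : ℝ))⁻¹ = (n : ℝ)⁻¹ := by
  rw [← mul_inv, Real.mul_self_sqrt n.cast_nonneg]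

theorem BoundedInMeasure.inv_sqrt_mul {f : ℕ → Ω → ℝ} (hf : BoundedInMeasure P f) :
    TendstoInMeasure P (fun (n : ℕ) ω => (√(n : ℝ))⁻¹ * f n ω) atTop fun _ => 0 :=
  (tendstoInMeasure_of_tendsto_const tendsto_inv_sqrt_atTop_zero).mul_boundedInMeasure hf

/-- An average tends to zero in probability when the root-`n` normalized sum is bounded. -/
theorem BoundedInMeasure.tendstoInMeasure_average {f : ℕ → Ω → ℝ}
    (hf : BoundedInMeasure P fun (n : ℕ) ω => (√(n : ℝ))⁻¹ * f n ω) :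
    TendstoInMeasure P (fun (n : ℕ) ω => (n : ℝ)⁻¹ * f n ω) atTop fun _ => 0 := by
  simpa only [← mul_assoc, inv_sqrt_mul_inv_sqrt_natCast] using hf.inv_sqrt_mul

end ConvergenceInMeasure

/-! ### Moments of products of independent variables -/

/-- The product of independent square integrable real functions is square integrable. -/
theorem ProbabilityTheory.IndepFun.memLp_two_mul {Ω : Type*} [MeasurableSpace Ω] {P : Measure Ω}
    {f g : Ω → ℝ} (h : IndepFun f g P) (hf : MemLp f 2 P) (hg : MemLp g 2 P) :
    MemLp (fun ω => f ω * g ω) 2 P := by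
  refine (memLp_two_iff_integrable_sq (hf.1.mul hg.1)).2 ?_
  have hsq : IndepFun (fun ω => f ω ^ 2) (fun ω => g ω ^ 2) P :=
    h.comp (measurable_id.pow_const 2) (measurable_id.pow_const 2)
  simp only [Pi.mul_apply, mul_pow]
  exact hsq.integrable_mul hf.integrable_sq hg.integrable_sq

theorem ProbabilityTheory.IndepFun.integral_mul_sq {Ω : Type*} [MeasurableSpace Ω] {P : Measure Ω}
    {f g : Ω → ℝ} (h : IndepFun f g P) (hf : MemLp f 2 P) (hg : MemLp g 2 P) :
    ∫ ω, (f ω * g ω) ^ 2 ∂P = (∫ ω, f ω ^ 2 ∂P) * ∫ ω, g ω ^ 2 ∂P := by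
  have hsq : IndepFun (fun ω => f ω ^ 2) (fun ω => g ω ^ 2) P :=
    h.comp (measurable_id.pow_const 2) (measurable_id.pow_const 2)
  simp_rw [mul_pow]
  exact hsq.integral_fun_mul_eq_mul_integral hf.integrable_sq.1 hg.integrable_sq.1

/-! ### Exact algebra of least squares -/

theorem olsEstimate_linearModel_sub {n p : ℕ} (G : Matrix (Fin n) (Fin 2 ⊕ Fin p) ℝ)
    (θ : Fin 2 ⊕ Fin p → ℝ) (u : Fin n → ℝ) (h : IsUnit (Gᵀ * G)) :
    olsEstimate G (G *ᵥ θ + u) - θ = (Gᵀ * G)⁻¹ *ᵥ (Gᵀ *ᵥ u) := by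
  have hdet := (Matrix.isUnit_iff_isUnit_det _).1 h
  simp only [olsEstimate, Matrix.mulVec_add, Matrix.mulVec_mulVec]
  rw [Matrix.nonsing_inv_mul _ hdet, Matrix.one_mulVec, add_sub_cancel_left]

/-- Writing `√n = n · (√n)⁻¹` puts each factor on the scale at which it is controlled: the Gram
matrix as an average, the score at root-`n` scale. -/
theorem sqrt_smul_olsEstimate_linearModel_sub {n p : ℕ} (hn : 0 < n)
    (G : Matrix (Fin n) (Fin 2 ⊕ Fin p) ℝ) (θ : Fin 2 ⊕ Fin p → ℝ) (u : Fin n → ℝ)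
    (h : IsUnit (Gᵀ * G)) :
    √(n : ℝ) • (olsEstimate G (G *ᵥ θ + u) - θ) =
      ((n : ℝ)⁻¹ • (Gᵀ * G))⁻¹ *ᵥ ((√(n : ℝ))⁻¹ • (Gᵀ *ᵥ u)) := by
  have hn' : (0 : ℝ) < n := Nat.cast_pos.2 hn
  have hs : 0 < √(n : ℝ) := Real.sqrt_pos.2 hn'
  have hdet := (Matrix.isUnit_iff_isUnit_det _).1 h
  have hinv : ((n : ℝ)⁻¹ • (Gᵀ * G))⁻¹ = (n : ℝ) • (Gᵀ * G)⁻¹ := by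
    refine Matrix.inv_eq_right_inv ?_
    rw [Matrix.smul_mul, Matrix.mul_smul, Matrix.mul_nonsing_inv _ hdet, smul_smul,
      inv_mul_cancel₀ hn'.ne', one_smul]
  rw [olsEstimate_linearModel_sub G θ u h, hinv, Matrix.smul_mulVec, Matrix.mulVec_smul, smul_smul]
  congr 1
  rw [eq_mul_inv_iff_mul_eq₀ hs.ne', Real.mul_self_sqrt hn'.le]

/-- Absorbing the omitted covariates into the noise turns the misspecified model into an exact
linear model with the same `θ`. -/
theorem outcome_eq_linearModel {Ω : Type*} {p q : ℕ} (μ₁ μ₂ : ℝ) (β : Fin (p + q) → ℝ)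
    (T : (n : ℕ) → Fin n → Ω → ℝ) (x : ℕ → Fin (p + q) → Ω → ℝ) (ε : ℕ → Ω → ℝ)
    (n : ℕ) (ω : Ω) :
    outcome μ₁ μ₂ β T x ε n ω = designMatrix T x n ω *ᵥ workingParameter μ₁ μ₂ β +
      (excludedCovariates x n ω *ᵥ excludedCoefficients β + fun i : Fin n => ε i ω) := by
  ext i
  simp only [outcome, designMatrix, workingParameter, excludedCovariates, excludedCoefficients,
    Matrix.mulVec, dotProduct, Pi.add_apply, Matrix.of_apply, Fintype.sum_sum_type,
    Sum.elim_inl, Sum.elim_inr, Fin.sum_univ_two, Fin.sum_univ_add, Matrix.cons_val_zero,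
    Matrix.cons_val_one]
  simp only [mul_comm (β _)]
  ring

/-! ### Large-sample theory of least squares -/

section LeastSquares

variable {Ω : Type*} [MeasurableSpace Ω] {P : Measure Ω}

theorem tendstoInMeasure_matrix_inv_sub {κ : Type*} [Fintype κ] [DecidableEq κ]
    {A : ℕ → Ω → Matrix κ κ ℝ} {V : Matrix κ κ ℝ} (hV : V.det ≠ 0)
    (hA : ∀ a b, TendstoInMeasure P (fun n ω => A n ω a b) atTop fun _ => V a b) (a b : κ) :
    TendstoInMeasure P (fun n ω => ((A n ω)⁻¹ - V⁻¹) a b) atTop fun _ => 0 := by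
  have hA' : TendstoInMeasure P (fun n ω a b => A n ω a b) atTop fun _ a b => V a b :=
    tendstoInMeasure_pi fun a => tendstoInMeasure_pi fun b => hA a b
  have hcont : ContinuousAt (fun M : κ → κ → ℝ => ((Matrix.of M)⁻¹ - V⁻¹) a b)
      (fun a b => V a b) := by
    have hinv : ContinuousAt (Inv.inv : Matrix κ κ ℝ → Matrix κ κ ℝ) V := by
      refine continuousAt_matrix_inv V ?_
      rw [Ring.inverse_eq_inv']
      exact continuousAt_inv₀ hV
    have hentry : Continuous fun M : Matrix κ κ ℝ => (M - V⁻¹) a b :=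
      (continuous_id.sub continuous_const).matrix_elem a b
    exact hentry.continuousAt.comp hinv
  have h0 := hA'.comp_continuousAt hcont
  have hzero : ((Matrix.of fun a b => V a b)⁻¹ - V⁻¹) a b = 0 := by
    change (V⁻¹ - V⁻¹) a b = 0
    rw [sub_self, Matrix.zero_apply]
  rw [hzero] at h0
  exact h0

/-- The determinants converge in probability to `det V ≠ 0`, while a singular matrix has determinant
at distance `|det V|` from it. -/
theorem tendsto_measure_not_isUnit {κ : Type*} [Fintype κ] [DecidableEq κ]
    {A : ℕ → Ω → Matrix κ κ ℝ} {V : Matrix κ κ ℝ} (hV : V.det ≠ 0)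
    (hA : ∀ a b, TendstoInMeasure P (fun n ω => A n ω a b) atTop fun _ => V a b) :
    Tendsto (fun n => P {ω | ¬ IsUnit (A n ω)}) atTop (𝓝 0) := by
  have hA' : TendstoInMeasure P (fun n ω a b => A n ω a b) atTop fun _ a b => V a b :=
    tendstoInMeasure_pi fun a => tendstoInMeasure_pi fun b => hA a b
  have hcont : Continuous fun M : κ → κ → ℝ => (Matrix.of M).det :=
    Continuous.matrix_det (A := fun M : Matrix κ κ ℝ => M) continuous_id
  have hdet := tendstoInMeasure_iff_norm.1 (hA'.comp_continuousAt hcont.continuousAt) |V.det|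
    (abs_pos.2 hV)
  refine tendsto_of_tendsto_of_tendsto_of_le_of_le tendsto_const_nhds hdet
    (fun _ => zero_le) fun n => measure_mono fun ω hω => ?_
  have h0 : (A n ω).det = 0 := by
    by_contra hne
    exact hω ((Matrix.isUnit_iff_isUnit_det _).2 (isUnit_iff_ne_zero.2 hne))
  change |V.det| ≤ ‖(A n ω).det - V.det‖
  rw [h0, zero_sub, norm_neg, Real.norm_eq_abs]

/-- Subadditivity alone gives `1 - P sᶜ ≤ P s`, so the sets need not be measurable. -/
theorem tendsto_measure_one_of_compl [IsProbabilityMeasure P] {s : ℕ → Set Ω}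
    (h : Tendsto (fun n => P (s n)ᶜ) atTop (𝓝 0)) : Tendsto (fun n => P (s n)) atTop (𝓝 1) := by
  have hlow : Tendsto (fun n => 1 - P (s n)ᶜ) atTop (𝓝 1) := by
    simpa using ENNReal.Tendsto.sub (tendsto_const_nhds (x := (1 : ENNReal))) h (by simp)
  refine tendsto_of_tendsto_of_tendsto_of_le_of_le hlow tendsto_const_nhds (fun n => ?_)
    fun n => prob_le_one
  rw [tsub_le_iff_right, ← measure_univ (μ := P), ← Set.union_compl_self (s n)]
  exact measure_union_le _ _

theorem boundedInMeasure_mulVec {κ ι : Type*} [Fintype κ] (M : Matrix ι κ ℝ)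
    {Z : ℕ → Ω → κ → ℝ} (hZ : ∀ a, BoundedInMeasure P fun n ω => Z n ω a) (b : ι) :
    BoundedInMeasure P fun n ω => (M *ᵥ Z n ω) b :=
  boundedInMeasure_finset_sum Finset.univ fun a _ => (hZ a).const_mul (M b a)

/-- Large sample behaviour of least squares in the linear model `Y = G θ + u`, when the normalized
Gram matrix has an invertible limit and the normalized score is bounded in probability. -/
theorem leastSquares_asymptotics [IsProbabilityMeasure P] {p : ℕ}
    {G : (n : ℕ) → Ω → Matrix (Fin n) (Fin 2 ⊕ Fin p) ℝ} {u : (n : ℕ) → Ω → Fin n → ℝ}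
    {V : Matrix (Fin 2 ⊕ Fin p) (Fin 2 ⊕ Fin p) ℝ} (θ : Fin 2 ⊕ Fin p → ℝ) (hV : V.det ≠ 0)
    (hGram : ∀ a b, TendstoInMeasure P
      (fun (n : ℕ) ω => (n : ℝ)⁻¹ * ((G n ω)ᵀ * G n ω) a b) atTop fun _ => V a b)
    (hscore : ∀ a, BoundedInMeasure P
      fun (n : ℕ) ω => (√(n : ℝ))⁻¹ * ((G n ω)ᵀ *ᵥ u n ω) a) :
    Tendsto (fun n : ℕ => P {ω | IsUnit ((G n ω)ᵀ * G n ω)}) atTop (𝓝 1) ∧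
    TendstoInMeasure P (fun (n : ℕ) ω => olsEstimate (G n ω) (G n ω *ᵥ θ + u n ω))
      atTop (fun _ => θ) ∧
    TendstoInMeasure P
      (fun (n : ℕ) ω => √(n : ℝ) • (olsEstimate (G n ω) (G n ω *ᵥ θ + u n ω) - θ) -
        (√(n : ℝ))⁻¹ • (V⁻¹ *ᵥ ((G n ω)ᵀ *ᵥ u n ω))) atTop (fun _ => 0) := by
  set A : ℕ → Ω → Matrix (Fin 2 ⊕ Fin p) (Fin 2 ⊕ Fin p) ℝ :=
    fun n ω => (n : ℝ)⁻¹ • ((G n ω)ᵀ * G n ω) with hAdef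
  set Z : ℕ → Ω → Fin 2 ⊕ Fin p → ℝ := fun n ω => (√(n : ℝ))⁻¹ • ((G n ω)ᵀ *ᵥ u n ω) with hZdef
  have hA : ∀ a b, TendstoInMeasure P (fun n ω => A n ω a b) atTop fun _ => V a b := hGram
  have hZ : ∀ a, BoundedInMeasure P fun n ω => Z n ω a := hscore
  have hsing : Tendsto (fun n => P {ω | ¬ IsUnit ((G n ω)ᵀ * G n ω)}) atTop (𝓝 0) := by
    refine (tendsto_measure_not_isUnit hV hA).congr' ?_
    filter_upwards [eventually_gt_atTop 0] with n hn
    have hn' : IsUnit (n : ℝ)⁻¹ := isUnit_iff_ne_zero.2 (by positivity)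
    congr 1
    ext ω
    simp only [hAdef, Set.mem_ofPred_eq, Matrix.isUnit_iff_isUnit_det, Matrix.det_smul]
    rw [IsUnit.mul_iff, and_iff_right (hn'.pow _)]
  have hrem : TendstoInMeasure P
      (fun (n : ℕ) ω => √(n : ℝ) • (olsEstimate (G n ω) (G n ω *ᵥ θ + u n ω) - θ) -
        (√(n : ℝ))⁻¹ • (V⁻¹ *ᵥ ((G n ω)ᵀ *ᵥ u n ω))) atTop (fun _ => 0) := by
    have hmain : TendstoInMeasure P (fun n ω => ((A n ω)⁻¹ - V⁻¹) *ᵥ Z n ω) atTop fun _ => 0 := by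
      refine tendstoInMeasure_pi fun a => ?_
      exact tendstoInMeasure_finset_sum_zero Finset.univ
        (f := fun b n ω => ((A n ω)⁻¹ - V⁻¹) a b * Z n ω b) fun b _ =>
          (tendstoInMeasure_matrix_inv_sub hV hA a b).mul_boundedInMeasure (hZ b)
    refine hmain.congr_of_tendsto_measure hsing ?_
    filter_upwards [eventually_gt_atTop 0] with n hn ω hω
    rw [sqrt_smul_olsEstimate_linearModel_sub hn _ _ _ (not_not.1 hω), Matrix.sub_mulVec]
    simp only [hAdef, hZdef, Matrix.mulVec_smul]
  refine ⟨tendsto_measure_one_of_compl hsing, ?_, hrem⟩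
  refine tendstoInMeasure_pi fun a => ?_
  have hcoord : TendstoInMeasure P (fun (n : ℕ) ω =>
      (√(n : ℝ) • (olsEstimate (G n ω) (G n ω *ᵥ θ + u n ω) - θ) -
        (√(n : ℝ))⁻¹ • (V⁻¹ *ᵥ ((G n ω)ᵀ *ᵥ u n ω))) a) atTop fun _ => 0 :=
    hrem.comp_continuousAt (g := fun v : Fin 2 ⊕ Fin p → ℝ => v a)
      (continuous_apply a).continuousAt
  -- The scaled error is the remainder plus `V⁻¹ Z`, hence bounded in probability; dividing by `√n`
  -- sends it to zero. The singular event is already absorbed in the remainder.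
  have hlim := ((hcoord.boundedInMeasure.add
    (boundedInMeasure_mulVec V⁻¹ hZ a)).inv_sqrt_mul).add_const_limits
      (tendstoInMeasure_of_tendsto_const (tendsto_const_nhds (x := θ a)))
  rw [zero_add] at hlim
  refine tendstoInMeasure_congr_eventually hlim ?_
  filter_upwards [eventually_gt_atTop 0] with n hn ω
  have hs : √(n : ℝ) ≠ 0 := (Real.sqrt_pos.2 (Nat.cast_pos.2 hn)).ne'
  simp only [hZdef, Matrix.mulVec_smul, Pi.sub_apply, Pi.smul_apply, smul_eq_mul]
  rw [sub_add_cancel, inv_mul_cancel_left₀ hs, sub_add_cancel]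

end LeastSquares

/-! ### Root-n bounds for weighted sums, and treatment proportions -/

section NormalizedSums

variable {Ω : Type*} [MeasurableSpace Ω] {P : Measure Ω}

theorem ProbabilityTheory.iIndepFun.integral_mul_eq_zero {ι : Type*} {f : ι → Ω → ℝ}
    (h : iIndepFun f P) (hf : ∀ i, MemLp (f i) 2 P) (hmean : ∀ i, ∫ ω, f i ω ∂P = 0) {i k : ι}
    (hik : i ≠ k) : ∫ ω, f i ω * f k ω ∂P = 0 := by
  rw [(h.indepFun hik).integral_fun_mul_eq_mul_integral (hf i).1 (hf k).1, hmean i, zero_mul]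

/-- Normalized sums of orthogonal errors with random weights that are independent of the errors are
bounded in probability. -/
theorem boundedInMeasure_inv_sqrt_mul_weighted_sum [IsFiniteMeasure P] {ε : ℕ → Ω → ℝ}
    {w : (n : ℕ) → Fin n → Ω → ℝ} {C σ : ℝ}
    (hε : ∀ i, MemLp (ε i) 2 P) (hσ : ∀ i, ∫ ω, ε i ω ^ 2 ∂P = σ)
    (horth : ∀ i k, i ≠ k → ∫ ω, ε i ω * ε k ω ∂P = 0)
    (hw : ∀ n i, MemLp (w n i) 2 P) (hC : ∀ n i, ∫ ω, w n i ω ^ 2 ∂P ≤ C)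
    (hindep : ∀ n, IndepFun (fun ω (i : Fin n) => ε i ω) (fun ω i => w n i ω) P) :
    BoundedInMeasure P fun (n : ℕ) ω => (√(n : ℝ))⁻¹ * ∑ i : Fin n, w n i ω * ε i ω := by
  have hpair : ∀ n (i : Fin n), IndepFun (w n i) (ε i) P := fun n i =>
    ((hindep n).comp (measurable_pi_apply i) (measurable_pi_apply i)).symm
  have hσ0 : 0 ≤ σ := by
    rw [← hσ 0]
    exact integral_nonneg fun ω => sq_nonneg _
  refine boundedInMeasure_inv_sqrt_mul_sum (C := C * σ)
    (fun n i => (hpair n i).memLp_two_mul (hw n i) (hε i)) (fun n i => ?_) fun n i k hik => ?_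
  · rw [(hpair n i).integral_mul_sq (hw n i) (hε i), hσ]
    exact mul_le_mul_of_nonneg_right (hC n i) hσ0
  -- The weights may depend on each other, so the errors are grouped against the weights: the factor
  -- `E[ε_i ε_k] = 0` kills the cross moment.
  · have hprod : IndepFun (fun ω => ε i ω * ε k ω) (fun ω => w n i ω * w n k ω) P :=
      (hindep n).comp (φ := fun v : Fin n → ℝ => v i * v k) (ψ := fun v : Fin n → ℝ => v i * v k)
        (by fun_prop) (by fun_prop)
    have heq : ∀ ω, w n i ω * ε i ω * (w n k ω * ε k ω) = ε i ω * ε k ω * (w n i ω * w n k ω) :=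
      fun ω => by ring
    simp_rw [heq]
    rw [hprod.integral_fun_mul_eq_mul_integral ((hε i).1.mul (hε k).1) ((hw n i).1.mul (hw n k).1),
      horth i k (Fin.val_injective.ne hik), zero_mul]

/-- Since `T = ((2T - 1) + 1) / 2`, the sum over treated units is half the imbalance plus half the
full sum. -/
theorem boundedInMeasure_sum_mul_treated {T : (n : ℕ) → Fin n → Ω → ℝ} {y : ℕ → Ω → ℝ}
    (hbal : BoundedInMeasure P
      fun (n : ℕ) ω => (√(n : ℝ))⁻¹ * ∑ i : Fin n, (2 * T n i ω - 1) * y i ω)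
    (hsum : BoundedInMeasure P fun (n : ℕ) ω => (√(n : ℝ))⁻¹ * ∑ i : Fin n, y i ω) :
    BoundedInMeasure P fun (n : ℕ) ω => (√(n : ℝ))⁻¹ * ∑ i : Fin n, T n i ω * y i ω := by
  refine ((hbal.const_mul 2⁻¹).add (hsum.const_mul 2⁻¹)).of_norm_le
    fun n ω => le_of_eq (congrArg norm ?_)
  have h : ∑ i : Fin n, T n i ω * y i ω =
      2⁻¹ * (∑ i : Fin n, (2 * T n i ω - 1) * y i ω) + 2⁻¹ * ∑ i : Fin n, y i ω := by
    rw [Finset.mul_sum, Finset.mul_sum, ← Finset.sum_add_distrib]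
    exact Finset.sum_congr rfl fun i _ => by ring
  rw [h]
  ring

theorem boundedInMeasure_sum_mul_control {T : (n : ℕ) → Fin n → Ω → ℝ} {y : ℕ → Ω → ℝ}
    (hbal : BoundedInMeasure P
      fun (n : ℕ) ω => (√(n : ℝ))⁻¹ * ∑ i : Fin n, (2 * T n i ω - 1) * y i ω)
    (hsum : BoundedInMeasure P fun (n : ℕ) ω => (√(n : ℝ))⁻¹ * ∑ i : Fin n, y i ω) :
    BoundedInMeasure P fun (n : ℕ) ω => (√(n : ℝ))⁻¹ * ∑ i : Fin n, (1 - T n i ω) * y i ω := by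
  refine (hsum.add ((boundedInMeasure_sum_mul_treated hbal hsum).const_mul (-1))).of_norm_le
    fun n ω => le_of_eq (congrArg norm ?_)
  simp_rw [sub_mul, one_mul, Finset.sum_sub_distrib]
  ring

theorem tendstoInMeasure_proportion_treated {T : (n : ℕ) → Fin n → Ω → ℝ}
    (hglobal : TendstoInMeasure P
      (fun (n : ℕ) ω => (n : ℝ)⁻¹ * ∑ i : Fin n, (2 * T n i ω - 1)) atTop (fun _ => 0)) :
    TendstoInMeasure P (fun (n : ℕ) ω => (n : ℝ)⁻¹ * ∑ i : Fin n, T n i ω) atTop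
      (fun _ => 1 / 2) := by
  have h := (hglobal.const_mul_const 2⁻¹).add_const_limits
    (tendstoInMeasure_of_tendsto_const (tendsto_const_nhds (x := (1 / 2 : ℝ))))
  rw [mul_zero, zero_add] at h
  refine tendstoInMeasure_congr_eventually h ?_
  filter_upwards [eventually_gt_atTop 0] with n hn ω
  have hn' : (n : ℝ) ≠ 0 := (Nat.cast_pos.2 hn).ne'
  rw [Finset.sum_sub_distrib, ← Finset.mul_sum]
  simp only [Finset.sum_const, Finset.card_univ, Fintype.card_fin, nsmul_eq_mul, mul_one]
  field_simp
  ring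

theorem tendstoInMeasure_proportion_control {T : (n : ℕ) → Fin n → Ω → ℝ}
    (hglobal : TendstoInMeasure P
      (fun (n : ℕ) ω => (n : ℝ)⁻¹ * ∑ i : Fin n, (2 * T n i ω - 1)) atTop (fun _ => 0)) :
    TendstoInMeasure P (fun (n : ℕ) ω => (n : ℝ)⁻¹ * ∑ i : Fin n, (1 - T n i ω)) atTop
      (fun _ => 1 / 2) := by
  refine tendstoInMeasure_proportion_treated (T := fun n i ω => 1 - T n i ω) ?_
  have h := hglobal.const_mul_const (-1)
  rw [mul_zero] at h
  refine tendstoInMeasure_congr_eventually h (.of_forall fun n ω => ?_)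
  rw [mul_left_comm, Finset.mul_sum]
  exact congrArg _ (Finset.sum_congr rfl fun i _ => by ring)

end NormalizedSums

/-! ### Gram matrix and score of the working model -/

section WorkingModel

variable {Ω : Type*} [MeasurableSpace Ω] {P : Measure Ω} {p q : ℕ}
  {T : (n : ℕ) → Fin n → Ω → ℝ} {x : ℕ → Fin (p + q) → Ω → ℝ}

/-- Binary assignments give `T² = T` and `T (1 - T) = 0`, so the treatment block is diagonal with
the two counts. Entries pairing an indicator with a covariate, or two distinct covariates, are
O_P(√n) sums and vanish after division by `n`. -/
theorem tendstoInMeasure_gram_designMatrix {X : Fin (p + q) → Ω → ℝ}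
    (hT_val : ∀ n i ω, T n i ω = 0 ∨ T n i ω = 1)
    (hglobal : TendstoInMeasure P
      (fun (n : ℕ) ω => (n : ℝ)⁻¹ * ∑ i : Fin n, (2 * T n i ω - 1)) atTop (fun _ => 0))
    (htreated : ∀ j, BoundedInMeasure P
      fun (n : ℕ) ω => (√(n : ℝ))⁻¹ * ∑ i : Fin n, T n i ω * x i j ω)
    (hcontrol : ∀ j, BoundedInMeasure P
      fun (n : ℕ) ω => (√(n : ℝ))⁻¹ * ∑ i : Fin n, (1 - T n i ω) * x i j ω)
    (hcross : ∀ j k, j ≠ k → BoundedInMeasure P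
      fun (n : ℕ) ω => (√(n : ℝ))⁻¹ * ∑ i : Fin n, x i j ω * x i k ω)
    (hsq : ∀ j, TendstoInMeasure P
      (fun (n : ℕ) ω => (n : ℝ)⁻¹ * ∑ i : Fin n, x i j ω ^ 2) atTop fun _ => variance (X j) P)
    (a b : Fin 2 ⊕ Fin p) :
    TendstoInMeasure P
      (fun (n : ℕ) ω => (n : ℝ)⁻¹ * ((designMatrix T x n ω)ᵀ * designMatrix T x n ω) a b)
      atTop fun _ => limitMatrix P X a b := by
  have hT_sq : ∀ n i ω, T n i ω * T n i ω = T n i ω := fun n i ω => by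
    rcases hT_val n i ω with h | h <;> simp [h]
  have hC_sq : ∀ n i ω, (1 - T n i ω) * (1 - T n i ω) = 1 - T n i ω := fun n i ω => by
    linear_combination hT_sq n i ω
  have hTC : ∀ n i ω, T n i ω * (1 - T n i ω) = 0 := fun n i ω => by
    linear_combination -hT_sq n i ω
  have hCT : ∀ n i ω, (1 - T n i ω) * T n i ω = 0 := fun n i ω => by
    linear_combination -hT_sq n i ω
  have hzero : TendstoInMeasure P (fun (_ : ℕ) (_ : Ω) => (0 : ℝ)) atTop fun _ => 0 :=
    tendstoInMeasure_of_tendsto_const tendsto_const_nhds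
  simp only [Matrix.mul_apply, Matrix.transpose_apply, designMatrix, Matrix.of_apply, limitMatrix]
  rcases a with a | j <;> rcases b with b | k
  · fin_cases a <;> fin_cases b
    · simpa [hT_sq] using tendstoInMeasure_proportion_treated hglobal
    · simpa [hTC, Matrix.diagonal] using hzero
    · simpa [hCT, Matrix.diagonal] using hzero
    · simpa [hC_sq] using tendstoInMeasure_proportion_control hglobal
  · fin_cases a
    · simpa using (htreated (Fin.castAdd q k)).tendstoInMeasure_average
    · simpa using (hcontrol (Fin.castAdd q k)).tendstoInMeasure_average
  · fin_cases b
    · simpa [mul_comm (x _ _ _)] using (htreated (Fin.castAdd q j)).tendstoInMeasure_average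
    · simpa [mul_comm (x _ _ _)] using (hcontrol (Fin.castAdd q j)).tendstoInMeasure_average
  · by_cases hjk : j = k
    · subst hjk
      simpa [sq] using hsq (Fin.castAdd q j)
    · have hne : Fin.castAdd q j ≠ Fin.castAdd q k := fun h => hjk (Fin.castAdd_injective p q h)
      simpa [hjk] using (hcross _ _ hne).tendstoInMeasure_average

theorem boundedInMeasure_score_designMatrix {ε : ℕ → Ω → ℝ} (β : Fin (p + q) → ℝ)
    (htreated : ∀ j, BoundedInMeasure P
      fun (n : ℕ) ω => (√(n : ℝ))⁻¹ * ∑ i : Fin n, T n i ω * x i j ω)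
    (hcontrol : ∀ j, BoundedInMeasure P
      fun (n : ℕ) ω => (√(n : ℝ))⁻¹ * ∑ i : Fin n, (1 - T n i ω) * x i j ω)
    (hcross : ∀ j k, j ≠ k → BoundedInMeasure P
      fun (n : ℕ) ω => (√(n : ℝ))⁻¹ * ∑ i : Fin n, x i j ω * x i k ω)
    (hεtreated : BoundedInMeasure P
      fun (n : ℕ) ω => (√(n : ℝ))⁻¹ * ∑ i : Fin n, T n i ω * ε i ω)
    (hεcontrol : BoundedInMeasure P
      fun (n : ℕ) ω => (√(n : ℝ))⁻¹ * ∑ i : Fin n, (1 - T n i ω) * ε i ω)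
    (hεx : ∀ j, BoundedInMeasure P
      fun (n : ℕ) ω => (√(n : ℝ))⁻¹ * ∑ i : Fin n, x i j ω * ε i ω)
    (a : Fin 2 ⊕ Fin p) :
    BoundedInMeasure P fun (n : ℕ) ω => (√(n : ℝ))⁻¹ * ((designMatrix T x n ω)ᵀ *ᵥ
      (excludedCovariates x n ω *ᵥ excludedCoefficients β + fun i : Fin n => ε i ω)) a := by
  have hcov : ∀ k : Fin q, BoundedInMeasure P fun (n : ℕ) ω =>
      (√(n : ℝ))⁻¹ * ∑ i : Fin n, designMatrix T x n ω i a * x i (Fin.natAdd p k) ω := by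
    intro k
    rcases a with a | j
    · fin_cases a
      · exact htreated _
      · exact hcontrol _
    -- An included index is below `p` and an excluded one is at least `p`, so no square of a
    -- covariate, with its nonzero mean, enters the score.
    · refine hcross _ _ fun h => ?_
      have := congrArg Fin.val h
      simp only [Fin.val_castAdd, Fin.val_natAdd] at this
      have := j.isLt
      omega
  have herr : BoundedInMeasure P fun (n : ℕ) ω =>
      (√(n : ℝ))⁻¹ * ∑ i : Fin n, designMatrix T x n ω i a * ε i ω := by
    rcases a with a | j
    · fin_cases a
      · exact hεtreated
      · exact hεcontrol
    · exact hεx _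
  refine ((boundedInMeasure_finset_sum Finset.univ fun k _ =>
    (hcov k).const_mul (β (Fin.natAdd p k))).add herr).of_norm_le
      fun n ω => le_of_eq (congrArg norm ?_)
  simp only [Matrix.mulVec, dotProduct, Matrix.transpose_apply, Pi.add_apply, excludedCovariates,
    excludedCoefficients, Matrix.of_apply, mul_add, Finset.sum_add_distrib, Finset.mul_sum]
  rw [Finset.sum_comm]
  congr 1
  exact Finset.sum_congr rfl fun k _ => Finset.sum_congr rfl fun i _ => by ring

end WorkingModel

/-! ### Verification of the probabilistic inputs -/

theorem theorem3p1 {Ω Ω' : Type*} [MeasurableSpace Ω] [MeasurableSpace Ω']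
    (P : Measure Ω) [IsProbabilityMeasure P] (P' : Measure Ω') [IsProbabilityMeasure P']
    (p q : ℕ) (μ₁ μ₂ : ℝ) (β : Fin (p + q) → ℝ)
    -- the covariates `x i j`, independent over units `i` and over `j`, distributed as `X j`
    (X : Fin (p + q) → Ω → ℝ) (x : ℕ → Fin (p + q) → Ω → ℝ)
    (hx_meas : ∀ i j, Measurable (x i j))
    (hx_ident : ∀ i j, IdentDistrib (x i j) (X j) P P)
    (hx_indep : iIndepFun (fun k : ℕ × Fin (p + q) => x k.1 k.2) P)
    (hX_sq : ∀ j, MemLp (X j) 2 P)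
    (hX_mean : ∀ j, ∫ ω, X j ω ∂P = 0)
    (hX_var : ∀ j : Fin p, 0 < variance (X (Fin.castAdd q j)) P)
    -- the random errors, i.i.d. with mean zero and finite variance
    (ε : ℕ → Ω → ℝ)
    (hε_meas : ∀ i, Measurable (ε i))
    (hε_ident : ∀ i, IdentDistrib (ε i) (ε 0) P P)
    (hε_indep : iIndepFun ε P)
    (hε_sq : MemLp (ε 0) 2 P)
    (hε_mean : ∫ ω, ε 0 ω ∂P = 0)
    -- the assignment `T n i` of the `i`-th unit in the experiment with `n` units
    (T : (n : ℕ) → Fin n → Ω → ℝ)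
    (hT_meas : ∀ n i, Measurable (T n i))
    (hT_val : ∀ n i ω, T n i ω = 0 ∨ T n i ω = 1)
    -- the errors are independent of the covariates, and of the assignments
    (hεx : IndepFun (fun ω i => ε i ω) (fun ω i j => x i j ω) P)
    (hεT : ∀ n, IndepFun (fun ω (i : Fin n) => ε i ω) (fun ω i => T n i ω) P)
    -- global balance
    (hglobal : TendstoInMeasure P
      (fun (n : ℕ) ω => (n : ℝ)⁻¹ * ∑ i : Fin n, (2 * T n i ω - 1)) atTop (fun _ => 0))
    -- covariate balance
    (ξ : Ω' → Fin (p + q) → ℝ)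
    (hξ_int : ∀ j, Integrable (fun ω => ξ ω j) P')
    (hξ_mean : ∀ j, ∫ ω, ξ ω j ∂P' = 0)
    (hbalance : TendstoInDistribution
      (fun (n : ℕ) ω (j : Fin (p + q)) =>
        (√(n : ℝ))⁻¹ * ∑ i : Fin n, (2 * T n i ω - 1) * x i j ω)
      atTop ξ (fun _ => P) P') :
    -- the estimate is well defined with probability tending to one
    Tendsto (fun n : ℕ => P {ω | IsUnit ((designMatrix T x n ω)ᵀ * designMatrix T x n ω)})
      atTop (𝓝 1) ∧
    -- consistency
    TendstoInMeasure P
      (fun (n : ℕ) ω => olsEstimate (designMatrix T x n ω) (outcome μ₁ μ₂ β T x ε n ω))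
      atTop (fun _ => workingParameter μ₁ μ₂ β) ∧
    -- the asymptotic representation, with a remainder that tends to zero in probability
    TendstoInMeasure P
      (fun (n : ℕ) ω =>
        √(n : ℝ) • (olsEstimate (designMatrix T x n ω) (outcome μ₁ μ₂ β T x ε n ω) -
          workingParameter μ₁ μ₂ β) -
        (√(n : ℝ))⁻¹ • ((limitMatrix P X)⁻¹ *ᵥ ((designMatrix T x n ω)ᵀ *ᵥ
          (excludedCovariates x n ω *ᵥ excludedCoefficients β + fun i : Fin n => ε i ω))))
      atTop (fun _ => 0) := by
  have hx_sq : ∀ i j, MemLp (x i j) 2 P := fun i j => (hx_ident i j).symm.memLp_snd (hX_sq j)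
  have hx_mean : ∀ i j, ∫ ω, x i j ω ∂P = 0 := fun i j =>
    (hx_ident i j).integral_eq.trans (hX_mean j)
  have hx_moment : ∀ i j, ∫ ω, x i j ω ^ 2 ∂P = variance (X j) P := fun i j => by
    rw [variance_of_integral_eq_zero (hX_sq j).1.aemeasurable (hX_mean j)]
    exact (hx_ident i j).sq.integral_eq
  have hε_memLp : ∀ i, MemLp (ε i) 2 P := fun i => (hε_ident i).symm.memLp_snd hε_sq
  have hε_moment : ∀ i, ∫ ω, ε i ω ^ 2 ∂P = ∫ ω, ε 0 ω ^ 2 ∂P := fun i =>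
    (hε_ident i).sq.integral_eq
  have hε_orth : ∀ i k, i ≠ k → ∫ ω, ε i ω * ε k ω ∂P = 0 := fun i k hik =>
    hε_indep.integral_mul_eq_zero hε_memLp (fun i => (hε_ident i).integral_eq.trans hε_mean) hik
  have hx_sum : ∀ j, BoundedInMeasure P fun (n : ℕ) ω => (√(n : ℝ))⁻¹ * ∑ i : Fin n, x i j ω :=
    fun j => boundedInMeasure_inv_sqrt_mul_sum (fun n i => hx_sq i j)
      (fun n i => (hx_moment i j).le) fun n i k hik =>
        hx_indep.integral_mul_eq_zero (i := ((i : ℕ), j)) (k := ((k : ℕ), j))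
          (fun k => hx_sq k.1 k.2) (fun k => hx_mean k.1 k.2)
          fun h => hik (Fin.val_injective (congrArg Prod.fst h))
  have hbal : ∀ j, BoundedInMeasure P
      fun (n : ℕ) ω => (√(n : ℝ))⁻¹ * ∑ i : Fin n, (2 * T n i ω - 1) * x i j ω := fun j =>
    hbalance.boundedInMeasure.of_norm_le fun n ω => norm_le_pi_norm
      (fun j => (√(n : ℝ))⁻¹ * ∑ i : Fin n, (2 * T n i ω - 1) * x i j ω) j
  have htreated : ∀ j, BoundedInMeasure P
      fun (n : ℕ) ω => (√(n : ℝ))⁻¹ * ∑ i : Fin n, T n i ω * x i j ω := fun j =>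
    boundedInMeasure_sum_mul_treated (y := fun i => x i j) (hbal j) (hx_sum j)
  have hcontrol : ∀ j, BoundedInMeasure P
      fun (n : ℕ) ω => (√(n : ℝ))⁻¹ * ∑ i : Fin n, (1 - T n i ω) * x i j ω := fun j =>
    boundedInMeasure_sum_mul_control (y := fun i => x i j) (hbal j) (hx_sum j)
  have hcross : ∀ j k, j ≠ k → BoundedInMeasure P
      fun (n : ℕ) ω => (√(n : ℝ))⁻¹ * ∑ i : Fin n, x i j ω * x i k ω := by
    intro j k hjk
    have hind : ∀ i, IndepFun (x i j) (x i k) P := fun i =>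
      hx_indep.indepFun (i := (i, j)) (j := (i, k)) fun h => hjk (congrArg Prod.snd h)
    refine boundedInMeasure_inv_sqrt_mul_sum (z := fun n i ω => x i j ω * x i k ω)
      (fun n i => (hind i).memLp_two_mul (hx_sq i j) (hx_sq i k))
      (C := variance (X j) P * variance (X k) P) (fun n i => ?_) fun n i l hil => ?_
    · rw [(hind i).integral_mul_sq (hx_sq i j) (hx_sq i k), hx_moment, hx_moment]
    · have hne : ∀ m m' : Fin (p + q), ((i : ℕ), m) ≠ ((l : ℕ), m') := fun m m' h =>
        hil (Fin.val_injective (congrArg Prod.fst h))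
      have hprod : IndepFun (fun ω => x i j ω * x i k ω) (fun ω => x l j ω * x l k ω) P :=
        hx_indep.indepFun_mul_mul (fun k => hx_meas k.1 k.2) ((i : ℕ), j) ((i : ℕ), k)
          ((l : ℕ), j) ((l : ℕ), k) (hne _ _) (hne _ _) (hne _ _) (hne _ _)
      rw [hprod.integral_fun_mul_eq_mul_integral ((hx_sq _ _).1.mul (hx_sq _ _).1)
          ((hx_sq _ _).1.mul (hx_sq _ _).1),
        (hind i).integral_fun_mul_eq_mul_integral (hx_sq _ _).1 (hx_sq _ _).1, hx_mean, zero_mul,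
        zero_mul]
  -- Fourth moments may be infinite, so Chebyshev is not available for the squares; the strong law
  -- needs only their integrability.
  have hsq : ∀ j, TendstoInMeasure P
      (fun (n : ℕ) ω => (n : ℝ)⁻¹ * ∑ i : Fin n, x i j ω ^ 2) atTop
      fun _ => variance (X j) P := by
    intro j
    refine tendstoInMeasure_of_tendsto_ae (fun n => Measurable.aestronglyMeasurable ?_) ?_
    · exact (Finset.measurable_fun_sum _ fun (i : Fin n) _ => (hx_meas i j).pow_const 2).const_mul _
    · have hlln := strong_law_ae_real (fun i ω => x i j ω ^ 2) (hx_sq 0 j).integrable_sq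
        (fun i k hik => (hx_indep.indepFun (i := (i, j)) (j := (k, j))
          fun h => hik (congrArg Prod.fst h)).comp
            (measurable_id.pow_const 2) (measurable_id.pow_const 2))
        fun i => ((hx_ident i j).trans (hx_ident 0 j).symm).sq
      filter_upwards [hlln] with ω hω
      rw [hx_moment] at hω
      refine hω.congr fun n => ?_
      rw [div_eq_inv_mul, Finset.sum_range]
  have hT_sq_le : ∀ n i ω, T n i ω ^ 2 ≤ 1 ∧ (1 - T n i ω) ^ 2 ≤ 1 := fun n i ω => by
    rcases hT_val n i ω with h | h <;> simp [h]
  have hT_memLp : ∀ n i, MemLp (T n i) 2 P := fun n i =>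
    MemLp.of_bound (hT_meas n i).aestronglyMeasurable 1 (.of_forall fun ω => by
      rcases hT_val n i ω with h | h <;> simp [h])
  have hC_memLp : ∀ n i, MemLp (fun ω => 1 - T n i ω) 2 P := fun n i =>
    (memLp_const 1).sub (hT_memLp n i)
  have hmoment_le : ∀ w : Ω → ℝ, MemLp w 2 P → (∀ ω, w ω ^ 2 ≤ 1) → ∫ ω, w ω ^ 2 ∂P ≤ 1 :=
    fun w hw h => by
      simpa using integral_mono hw.integrable_sq (integrable_const (1 : ℝ)) h
  have hεtreated := boundedInMeasure_inv_sqrt_mul_weighted_sum hε_memLp hε_moment hε_orth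
    hT_memLp (fun n i => hmoment_le _ (hT_memLp n i) fun ω => (hT_sq_le n i ω).1) hεT
  have hεcontrol := boundedInMeasure_inv_sqrt_mul_weighted_sum (w := fun n i ω => 1 - T n i ω)
    hε_memLp hε_moment hε_orth hC_memLp
    (fun n i => hmoment_le _ (hC_memLp n i) fun ω => (hT_sq_le n i ω).2)
    fun n => (hεT n).comp (ψ := fun (v : Fin n → ℝ) i => 1 - v i) measurable_id (by fun_prop)
  have hεcov : ∀ j, BoundedInMeasure P
      fun (n : ℕ) ω => (√(n : ℝ))⁻¹ * ∑ i : Fin n, x i j ω * ε i ω := fun j =>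
    boundedInMeasure_inv_sqrt_mul_weighted_sum (w := fun n i ω => x i j ω)
      hε_memLp hε_moment hε_orth (fun n i => hx_sq i j) (fun n i => (hx_moment i j).le)
      fun n => hεx.comp (φ := fun (v : ℕ → ℝ) (i : Fin n) => v i)
        (ψ := fun (v : ℕ → Fin (p + q) → ℝ) (i : Fin n) => v i j)
        (by fun_prop) (by fun_prop)
  have hdet : (limitMatrix P X).det ≠ 0 := by
    rw [limitMatrix, Matrix.det_diagonal, Finset.prod_ne_zero_iff]
    rintro (a | j) -
    · norm_num
    · exact (hX_var j).ne'
  simp only [outcome_eq_linearModel]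
  exact leastSquares_asymptotics (workingParameter μ₁ μ₂ β) hdet
    (tendstoInMeasure_gram_designMatrix hT_val hglobal htreated hcontrol hcross hsq)
    (boundedInMeasure_score_designMatrix β htreated hcontrol hcross hεtreated hεcontrol hεcov)
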